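/- Let $G$ be a local analytic Moufang loop, written in a coordinate neighbourhood of its unit: $G$ is an open subset of a finite-dimensional real vector space $E$ with a unit $e\in G$ and a real analytic product $(g,h)\mapsto gh\in G$ defined on an open set of pairs $D\subseteq G\times G$ that contains $\{e\}\times G$ and $G\times\{e\}$, such that $eg=ge=g$ for all $g\in G$; for $g,k$ near $e$ each of the equations $gh=k$ and $hg=k$ has a unique solution $h$; and the Moufang identity $(gh)(kg)=g((hk)g)$ holds whenever all products in it are defined. Identify $T_e(G)$ with $E$. For $x\in T_e(G)$ let the infinitesimal translations be the vector fields on $G$ $$L_x(g)=\frac{d}{dt}\Big|_{t=0}(e+tx)\,g,\qquad R_x(g)=\frac{d}{dt}\Big|_{t=0}g\,(e+tx),\qquad M_x=-L_x-R_x,$$ and let $[\cdot,\cdot]$ of vector fields be the Lie bracket. Let $a(x,y)$ be the mixed second derivative of the product at $(e,e)$ in the direction $x$ of the first and $y$ of the second argument, let $[x,y]=a(x,y)-a(y,x)$ be the product of the tangent algebra, and define the Yamaguti brackets, the Loos brackets and the Yamagutian by $$[x,y,z]=[x,[y,z]]-[y,[x,z]]+[[x,y],z],\qquad 3\{x,y,z\}=[x,y,z]+[[x,y],z],$$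 $$6\,Y(x;y)=[L_x,L_y]+[R_x,R_y]+[M_x,M_y].$$ Then the triple closure relations $$[[L_x,L_y],L_z]=L_{\{x,y,z\}},\qquad [[R_x,R_y],R_z]=R_{\{x,y,z\}},\qquad [[M_x,M_y],M_z]=M_{\{x,y,z\}}$$ hold on $G$ for all $x,y,z\in T_e(G)$. Moreover, these relations hold (for all $x,y,z$) if and only if the reductivity relations $$6\,[Y(x;y),L_z]=L_{[x,y,z]},\qquad 6\,[Y(x;y),R_z]=R_{[x,y,z]},\qquad 6\,[Y(x;y),M_z]=M_{[x,y,z]}$$ hold for all $x,y,z\in T_e(G)$. -/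

import Mathlib

open Filter Topology VectorField

noncomputable section

/-- A local analytic Moufang loop, written in a coordinate neighbourhood of its unit: an open
subset `carrier` of a real normed space `E` (finite-dimensional in the theorem), a unit, and an
analytic product defined on an open set `dom` of pairs, such that products with the unit are
always defined, two of the elements `g`, `h`, `g * h` near the unit determine the third one, and
the Moufang identity `(g h)(k g) = g ((h k) g)` holds whenever all products in it are defined.
The values of `mul` outside `dom` carry no meaning. Analyticity of the inversion and of the
divisions near the unit follows from that of the product by the inverse function theorem. -/
structure LocalAnalyticMoufangLoop (E : Type*) [NormedAddCommGroup E] [NormedSpace ℝ E] where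
  /-- the underlying set of the local loop -/
  carrier : Set E
  /-- the pairs whose product is defined -/
  dom : Set (E × E)
  /-- the unit -/
  one : E
  /-- the product (meaningful on `dom`) -/
  mul : E → E → E
  isOpen_carrier : IsOpen carrier
  isOpen_dom : IsOpen dom
  dom_subset : dom ⊆ carrier ×ˢ carrier
  one_mem : one ∈ carrier
  mul_mem : ∀ g h, (g, h) ∈ dom → mul g h ∈ carrier
  analytic_mul : AnalyticOnNhd ℝ (fun p : E × E => mul p.1 p.2) dom
  one_mul_dom : ∀ g ∈ carrier, (one, g) ∈ dom
  mul_one_dom : ∀ g ∈ carrier, (g, one) ∈ dom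
  one_mul : ∀ g ∈ carrier, mul one g = g
  mul_one : ∀ g ∈ carrier, mul g one = g
  left_div : ∀ᶠ p : E × E in 𝓝 (one, one), ∃! h, (p.1, h) ∈ dom ∧ mul p.1 h = p.2
  right_div : ∀ᶠ p : E × E in 𝓝 (one, one), ∃! g, (g, p.1) ∈ dom ∧ mul g p.1 = p.2
  moufang : ∀ g h k, (g, h) ∈ dom → (k, g) ∈ dom → (mul g h, mul k g) ∈ dom →
    (h, k) ∈ dom → (mul h k, g) ∈ dom → (g, mul (mul h k) g) ∈ dom →
    mul (mul g h) (mul k g) = mul g (mul (mul h k) g)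

namespace LocalAnalyticMoufangLoop

variable {E : Type*} [NormedAddCommGroup E] [NormedSpace ℝ E] (G : LocalAnalyticMoufangLoop E)

/-- The infinitesimal left translation `L_x`: the vector field `g ↦ d/da (a g)` at `a = e`,
applied to the tangent vector `x` at the unit. -/
def L (x : E) : E → E := fun g => fderiv ℝ (fun a => G.mul a g) G.one x

/-- The infinitesimal right translation `R_x`: the vector field `g ↦ d/da (g a)` at `a = e`,
applied to the tangent vector `x` at the unit. -/
def R (x : E) : E → E := fun g => fderiv ℝ (fun a => G.mul g a) G.one x

/-- The infinitesimal middle translation `M_x`, with `L_x + R_x + M_x = 0`: the generator of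
`h ↦ a⁻¹ (h a⁻¹)`. -/
def M (x : E) : E → E := fun g => -(G.L x g + G.R x g)

/-- The bilinear term `a(x, y)` in the Taylor expansion of the product at the unit
(in coordinates centred at the unit, `(g h)^i = g^i + h^i + a^i_{jk} g^j h^k + …`):
the mixed second derivative of the product in the directions `x` (first argument) and
`y` (second argument). -/
def taylorCoeff (x y : E) : E :=
  fderiv ℝ (fun h => fderiv ℝ (fun g => G.mul g h) G.one x) G.one y

/-- The product `[x, y]` of the tangent algebra, `[x, y]^i = (a^i_{jk} - a^i_{kj}) x^j y^k`. -/
def bracket (x y : E) : E := G.taylorCoeff x y - G.taylorCoeff y x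

/-- The Yamaguti bracket `[x, y, z] = [x, [y, z]] - [y, [x, z]] + [[x, y], z]`. -/
def yamaguti (x y z : E) : E :=
  G.bracket x (G.bracket y z) - G.bracket y (G.bracket x z) + G.bracket (G.bracket x y) z

/-- The Loos bracket, `3 {x, y, z} = [x, y, z] + [[x, y], z]`. -/
def loos (x y z : E) : E :=
  (1 / 3 : ℝ) • (G.yamaguti x y z + G.bracket (G.bracket x y) z)

/-- The Yamagutian, `6 Y(x; y) = [L_x, L_y] + [R_x, R_y] + [M_x, M_y]` (a vector field). -/
def Y (x y : E) : E → E := fun g =>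
  (1 / 6 : ℝ) • (lieBracket ℝ (G.L x) (G.L y) g + lieBracket ℝ (G.R x) (G.R y) g
    + lieBracket ℝ (G.M x) (G.M y) g)

/-- Triple closure of a family `T_x` of vector fields: `[[T_x, T_y], T_z] = T_{{x, y, z}}`
on the local loop. -/
def TripleClosed (T : E → E → E) : Prop :=
  ∀ x y z : E, ∀ g ∈ G.carrier,
    lieBracket ℝ (lieBracket ℝ (T x) (T y)) (T z) g = T (G.loos x y z) g

/-- Reductivity of a family `T_x` of vector fields: `6 [Y(x; y), T_z] = T_{[x, y, z]}`
on the local loop. -/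
def Reductive (T : E → E → E) : Prop :=
  ∀ x y z : E, ∀ g ∈ G.carrier,
    (6 : ℝ) • lieBracket ℝ (G.Y x y) (T z) g = T (G.yamaguti x y z) g

end LocalAnalyticMoufangLoop

end

/-! The Moufang identity enters only through its derivatives up to second order at the unit.
Differentiating `(a h)(b a) = a ((h b) a)` and `(a b)(k a) = a ((b k) a)` first in `b` and then in
`a` at the unit gives formulas for `R` and `L` of a Taylor coefficient (`R_taylorCoeff`,
`L_taylorCoeff`). Antisymmetrizing removes the pure second derivatives of the product. The flexible
law, to second order and polarized, gives `[L_x, R_y] = [R_x, L_y]` (`lieBracket_L_R`). Together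
these are the generalized Maurer–Cartan relations `L_[x,y] = -[L_x, L_y] - 2[L_x, R_y]` and `R_[x,y]
= [R_x, R_y] + 2[L_x, R_y]`.

The rest is algebra in the Lie algebra of smooth vector fields on the carrier. Write `J` for the
Jacobian of the tangent product. The Jacobi identities for all triples of `L`s and `R`s form a
linear system for the brackets `[[L_x, R_y], L_z]` and `[[L_x, R_y], R_z]`, solved in
`lie_lie_left_right_left` and `lie_lie_left_right_right`. Substitution gives triple brackets with
argument `[[x,y],z] - J/3`, which is the Loos bracket, and Yamagutian brackets with argument
`2[[x,y],z] - J`, which is the Yamaguti bracket. Triple closure and reductivity thus both follow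
from the same relations, and the equivalence holds because both sides do. -/

noncomputable section

/-! ### Lie algebra consequences of the generalized Maurer–Cartan relations. -/

section TrialityRelations

/-- A pair of linear maps `L`, `R` from a space with an anticommutative product `β` to a real Lie
algebra, subject to the generalized Maurer–Cartan relations of a Moufang loop. -/
structure IsMoufangPair {V 𝔤 : Type*} [AddCommGroup V] [Module ℝ V] [LieRing 𝔤] [LieAlgebra ℝ 𝔤]
    (β : V → V → V) (L R : V →ₗ[ℝ] 𝔤) : Prop where
  swap : ∀ x y, β x y = -β y x
  comm : ∀ x y, ⁅L x, R y⁆ = ⁅R x, L y⁆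
  left : ∀ x y, L (β x y) = -⁅L x, L y⁆ - (2 : ℝ) • ⁅L x, R y⁆
  right : ∀ x y, R (β x y) = ⁅R x, R y⁆ + (2 : ℝ) • ⁅L x, R y⁆

namespace IsMoufangPair

variable {V 𝔤 : Type*} [AddCommGroup V] [Module ℝ V] [LieRing 𝔤] [LieAlgebra ℝ 𝔤]
  {β : V → V → V} {L R : V →ₗ[ℝ] 𝔤}

/-- The Jacobian of an anticommutative product. -/
def jacobian (β : V → V → V) (x y z : V) : V := β (β x y) z + β (β y z) x + β (β z x) y

lemma lie_left_left (h : IsMoufangPair β L R) (x y : V) :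
    ⁅L x, L y⁆ = -L (β x y) - (2 : ℝ) • ⁅L x, R y⁆ := by
  rw [h.left]; module

lemma lie_right_right (h : IsMoufangPair β L R) (x y : V) :
    ⁅R x, R y⁆ = R (β x y) - (2 : ℝ) • ⁅L x, R y⁆ := by
  rw [h.right]; module

lemma lie_left_right_swap (h : IsMoufangPair β L R) (x y : V) :
    ⁅L x, R y⁆ = -⁅L y, R x⁆ := by
  rw [h.comm, lie_skew]

/-- The Jacobi identity for `L x`, `L y`, `R z`. -/
lemma jacobi_left (h : IsMoufangPair β L R) (x y z : V) :
    (2 : ℝ) • ⁅⁅L x, R y⁆, R z⁆ =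
      ⁅⁅L y, R z⁆, L x⁆ + ⁅⁅L z, R x⁆, L y⁆ - ⁅L (β x y), R z⁆ := by
  have j := lie_lie (L x) (L y) (R z)
  rw [h.lie_left_left x y, sub_lie, neg_lie, smul_lie, ← lie_skew (L x) ⁅L y, R z⁆,
    ← lie_skew (L y) ⁅L x, R z⁆, h.lie_left_right_swap x z, neg_lie] at j
  linear_combination (norm := module) (-1 : ℝ) • j

/-- The Jacobi identity for `R x`, `R y`, `L z`. -/
lemma jacobi_right (h : IsMoufangPair β L R) (x y z : V) :
    (2 : ℝ) • ⁅⁅L x, R y⁆, L z⁆ =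
      ⁅⁅L y, R z⁆, R x⁆ + ⁅⁅L z, R x⁆, R y⁆ + ⁅L (β x y), R z⁆ := by
  have j := lie_lie (R x) (R y) (L z)
  rw [h.lie_right_right x y, sub_lie, smul_lie, ← h.comm y z, ← h.comm x z, ← h.comm (β x y) z,
    ← lie_skew (R x) ⁅L y, R z⁆,
    ← lie_skew (R y) ⁅L x, R z⁆, h.lie_left_right_swap x z, neg_lie] at j
  linear_combination (norm := module) (-1 : ℝ) • j

/-- Put `P = [[L_x, R_y], L_z]`, `C = [L_[x,y], R_z]`, and let `Σ` denote cyclic sums. Eliminating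
the brackets with an outer `R` between `jacobi_right` and two instances of `jacobi_left` leaves `P =
C + (ΣP - ΣC)/3`. The Jacobi identity for three `L`s gives `ΣP - ΣC = L_J / 2`. -/
lemma lie_lie_left_right_left (h : IsMoufangPair β L R) (x y z : V) :
    ⁅⁅L x, R y⁆, L z⁆ = ⁅L (β x y), R z⁆ + (1 / 6 : ℝ) • L (jacobian β x y z) := by
  have e1 := h.jacobi_left x y z
  have e2 := h.jacobi_left y z x
  have e3 := h.jacobi_left z x y
  have f1 := h.jacobi_right x y z
  have f2 := h.jacobi_right y z x
  have f3 := h.jacobi_right z x y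
  have j := lie_lie (L x) (L y) (L z)
  rw [← lie_skew (L x) ⁅L y, L z⁆, ← lie_skew (L y) ⁅L x, L z⁆, ← lie_skew (L x) (L z), neg_lie,
    h.lie_left_left x y, h.lie_left_left y z, h.lie_left_left z x] at j
  simp only [sub_lie, neg_lie, smul_lie, h.lie_left_left (β _ _)] at j
  simp only [jacobian, map_add]
  -- The terms `f1`, `e2`, `e3` perform the elimination; `j` evaluates the cyclic sum, and `1/6` is
  -- `1/3` times `1/2`.
  linear_combination (norm := module) (2 / 3 : ℝ) • f1 + (1 / 3 : ℝ) • e2 + (1 / 3 : ℝ) • e3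
    - (1 / 6 : ℝ) • j

lemma lie_lie_left_right_right (h : IsMoufangPair β L R) (x y z : V) :
    ⁅⁅L x, R y⁆, R z⁆ = -⁅L (β x y), R z⁆ + (1 / 6 : ℝ) • R (jacobian β x y z) := by
  have e1 := h.jacobi_left x y z
  have e2 := h.jacobi_left y z x
  have e3 := h.jacobi_left z x y
  have f1 := h.jacobi_right x y z
  have f2 := h.jacobi_right y z x
  have f3 := h.jacobi_right z x y
  have j := lie_lie (R x) (R y) (R z)
  rw [← lie_skew (R x) ⁅R y, R z⁆, ← lie_skew (R y) ⁅R x, R z⁆, ← lie_skew (R x) (R z), neg_lie,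
    h.lie_right_right x y, h.lie_right_right y z, h.lie_right_right z x] at j
  simp only [sub_lie, smul_lie, h.lie_right_right (β _ _)] at j
  simp only [jacobian, map_add]
  linear_combination (norm := module) (2 / 3 : ℝ) • e1 + (1 / 3 : ℝ) • f2 + (1 / 3 : ℝ) • f3
    - (1 / 6 : ℝ) • j

/-- The mixed terms `[L_[x,y], R_z]` coming from `[L_[x,y], L_z]` and from `[[L_x, R_y], L_z]`
cancel, so only values of `L` remain. -/
lemma left_triple (h : IsMoufangPair β L R) (x y z : V) :
    ⁅⁅L x, L y⁆, L z⁆ = L (β (β x y) z) - (1 / 3 : ℝ) • L (jacobian β x y z) := by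
  rw [h.lie_left_left, sub_lie, neg_lie, smul_lie, h.lie_left_left, h.lie_lie_left_right_left]
  module

lemma right_triple (h : IsMoufangPair β L R) (x y z : V) :
    ⁅⁅R x, R y⁆, R z⁆ = R (β (β x y) z) - (1 / 3 : ℝ) • R (jacobian β x y z) := by
  rw [h.lie_right_right, sub_lie, smul_lie, h.lie_right_right, h.lie_lie_left_right_right]
  module

/-- The Yamagutian `[L x, L y] + [R x, R y] + [M x, M y]` (without the factor `1 / 6`). -/
lemma yamagutian_eq (h : IsMoufangPair β L R) (x y : V) :
    ⁅L x, L y⁆ + ⁅R x, R y⁆ + ⁅-(L x + R x), -(L y + R y)⁆ =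
      (2 : ℝ) • R (β x y) - (2 : ℝ) • L (β x y) - (6 : ℝ) • ⁅L x, R y⁆ := by
  simp only [neg_lie, lie_neg, add_lie, lie_add, ← h.comm x y, h.lie_left_left, h.lie_right_right]
  module

lemma middle_triple (h : IsMoufangPair β L R) (x y z : V) :
    ⁅⁅-(L x + R x), -(L y + R y)⁆, -(L z + R z)⁆ =
      -((L (β (β x y) z) - (1 / 3 : ℝ) • L (jacobian β x y z)) +
        (R (β (β x y) z) - (1 / 3 : ℝ) • R (jacobian β x y z))) := by
  have e : ⁅-(L x + R x), -(L y + R y)⁆ = R (β x y) - L (β x y) - (2 : ℝ) • ⁅L x, R y⁆ := by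
    simp only [neg_lie, lie_neg, add_lie, lie_add, ← h.comm x y, h.lie_left_left,
      h.lie_right_right]
    module
  rw [e]
  simp only [sub_lie, smul_lie, lie_neg, lie_add, h.lie_lie_left_right_left,
    h.lie_lie_left_right_right, h.lie_left_left, h.lie_right_right, ← h.comm (β x y)]
  module

lemma yamagutian_left (h : IsMoufangPair β L R) (x y z : V) :
    ⁅⁅L x, L y⁆ + ⁅R x, R y⁆ + ⁅-(L x + R x), -(L y + R y)⁆, L z⁆ =
      (2 : ℝ) • L (β (β x y) z) - L (jacobian β x y z) := by
  rw [h.yamagutian_eq]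
  simp only [sub_lie, smul_lie, h.lie_lie_left_right_left, h.lie_left_left, ← h.comm (β x y)]
  module

lemma yamagutian_right (h : IsMoufangPair β L R) (x y z : V) :
    ⁅⁅L x, L y⁆ + ⁅R x, R y⁆ + ⁅-(L x + R x), -(L y + R y)⁆, R z⁆ =
      (2 : ℝ) • R (β (β x y) z) - R (jacobian β x y z) := by
  rw [h.yamagutian_eq]
  simp only [sub_lie, smul_lie, h.lie_lie_left_right_right, h.lie_right_right]
  module

end IsMoufangPair

end TrialityRelations

/-! ### The Lie algebra of smooth vector fields on an open set. -/

section SmoothVectorFields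

open scoped ContDiff

variable {E : Type*} [NormedAddCommGroup E] [NormedSpace ℝ E]

/-- Vector fields that are smooth on an open set, extended by zero. -/
def smoothVectorFields (s : TopologicalSpace.Opens E) : Submodule ℝ (E → E) where
  carrier := {V | ContDiffOn ℝ ∞ V s ∧ ∀ x ∉ s, V x = 0}
  add_mem' hV hW := ⟨hV.1.add hW.1, fun x hx => by simp [hV.2 x hx, hW.2 x hx]⟩
  zero_mem' := ⟨contDiffOn_const, fun _ _ => rfl⟩
  smul_mem' c _ hV := ⟨hV.1.const_smul c, fun x hx => by simp [hV.2 x hx]⟩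

namespace smoothVectorFields

variable {s : TopologicalSpace.Opens E}

lemma contDiffAt (V : smoothVectorFields s) {x : E} (hx : x ∈ s) : ContDiffAt ℝ ∞ V.1 x :=
  V.2.1.contDiffAt (s.isOpen.mem_nhds hx)

lemma differentiableAt (V : smoothVectorFields s) {x : E} (hx : x ∈ s) :
    DifferentiableAt ℝ V.1 x := (contDiffAt V hx).differentiableAt (by simp)

/-- A vector field smooth on `s`, cut off outside `s`. -/
def ofContDiffOn {V : E → E} (hV : ContDiffOn ℝ ∞ V s) : smoothVectorFields s :=
  ⟨(s : Set E).indicator V, hV.congr fun _ hx => Set.indicator_of_mem hx V,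
    fun _ hx => Set.indicator_of_notMem hx V⟩

lemma ofContDiffOn_apply {V : E → E} (hV : ContDiffOn ℝ ∞ V s) {x : E} (hx : x ∈ s) :
    (ofContDiffOn hV).1 x = V x := Set.indicator_of_mem hx V

/-- Extension by zero makes agreement on `s` the same as equality, so identities valid only on the
carrier become identities in a Lie algebra. -/
lemma ext_on {V W : smoothVectorFields s} (h : ∀ x ∈ s, V.1 x = W.1 x) : V = W := by
  apply Subtype.ext
  funext x
  by_cases hx : x ∈ s
  · exact h x hx
  · rw [V.2.2 x hx, W.2.2 x hx]

lemma contDiffOn_lieBracket (V W : smoothVectorFields s) :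
    ContDiffOn ℝ ∞ (lieBracket ℝ V.1 W.1) s := fun _ hx =>
  ((contDiffAt V hx).lieBracket_vectorField (contDiffAt W hx) (by simp)).contDiffWithinAt

instance : Bracket (smoothVectorFields s) (smoothVectorFields s) :=
  ⟨fun V W => ofContDiffOn (contDiffOn_lieBracket V W)⟩

lemma bracket_apply (V W : smoothVectorFields s) {x : E} (hx : x ∈ s) :
    (⁅V, W⁆ : smoothVectorFields s).1 x = lieBracket ℝ V.1 W.1 x :=
  ofContDiffOn_apply (contDiffOn_lieBracket V W) hx

lemma lieBracket_eq {V W : smoothVectorFields s} {A B : E → E}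
    (hA : ∀ x ∈ s, V.1 x = A x) (hB : ∀ x ∈ s, W.1 x = B x) :
    ∀ x ∈ s, (⁅V, W⁆ : smoothVectorFields s).1 x = lieBracket ℝ A B x := by
  intro x hx
  rw [bracket_apply V W hx]
  exact Filter.EventuallyEq.lieBracket_vectorField_eq
    (Filter.eventually_of_mem (s.isOpen.mem_nhds hx) hA)
    (Filter.eventually_of_mem (s.isOpen.mem_nhds hx) hB)

instance [CompleteSpace E] : LieRing (smoothVectorFields s) where
  add_lie U V W := ext_on fun x hx => by
    simpa [bracket_apply _ _ hx] using
      lieBracket_add_left (W := W.1) (differentiableAt U hx) (differentiableAt V hx)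
  lie_add U V W := ext_on fun x hx => by
    simpa [bracket_apply _ _ hx] using
      lieBracket_add_right (V := U.1) (differentiableAt V hx) (differentiableAt W hx)
  lie_self V := ext_on fun x hx => by simp [bracket_apply _ _ hx]
  leibniz_lie U V W := ext_on fun x hx => by
    have h := leibniz_identity_lieBracket (𝕜 := ℝ) (n := ∞) (by simpa using ENat.LEInfty.out)
      (contDiffAt U hx) (contDiffAt V hx) (contDiffAt W hx)
    rw [lieBracket_eq (fun _ _ => rfl) (fun _ => bracket_apply V W) x hx, h, Submodule.coe_add,
      Pi.add_apply, lieBracket_eq (fun _ => bracket_apply U V) (fun _ _ => rfl) x hx,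
      lieBracket_eq (fun _ _ => rfl) (fun _ => bracket_apply U W) x hx]

instance [CompleteSpace E] : LieAlgebra ℝ (smoothVectorFields s) where
  lie_smul c V W := ext_on fun x hx => by
    simpa [bracket_apply _ _ hx] using
      lieBracket_const_smul_right (V := V.1) (c := c) (differentiableAt W hx)

end smoothVectorFields

end SmoothVectorFields

end

/-! ### Derivatives of the product and of the infinitesimal translations. -/

noncomputable section

namespace LocalAnalyticMoufangLoop

open scoped ContDiff

variable {E : Type*} [NormedAddCommGroup E] [NormedSpace ℝ E] (G : LocalAnalyticMoufangLoop E)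

/-- The product as a function of pairs. -/
def prodMul (p : E × E) : E := G.mul p.1 p.2

/-- The derivative of the product. -/
def dMul : E × E → (E × E →L[ℝ] E) := fderiv ℝ G.prodMul

/-- The second derivative of the product. -/
def ddMul : E × E → (E × E →L[ℝ] E × E →L[ℝ] E) := fderiv ℝ G.dMul

section Basic

variable {G}

lemma L_add (x y : E) : G.L (x + y) = G.L x + G.L y := by funext; simp [L]

lemma L_smul (c : ℝ) (x : E) : G.L (c • x) = c • G.L x := by funext; simp [L]

lemma R_add (x y : E) : G.R (x + y) = G.R x + G.R y := by funext; simp [R]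

lemma R_smul (c : ℝ) (x : E) : G.R (c • x) = c • G.R x := by funext; simp [R]

lemma carrier_mem_nhds {h : E} (hh : h ∈ G.carrier) : G.carrier ∈ 𝓝 h :=
  G.isOpen_carrier.mem_nhds hh

lemma eventually_dom {X : Type*} [TopologicalSpace X] {f g : X → E} {t : X}
    (hf : ContinuousAt f t) (hg : ContinuousAt g t) (hp : (f t, g t) ∈ G.dom) :
    ∀ᶠ s in 𝓝 t, (f s, g s) ∈ G.dom :=
  (hf.prodMk hg).eventually (G.isOpen_dom.mem_nhds hp)

/-- All products in the Moufang identity are defined at `(g, h, k)`. -/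
def MoufangDefined (G : LocalAnalyticMoufangLoop E) (g h k : E) : Prop :=
  (g, h) ∈ G.dom ∧ (k, g) ∈ G.dom ∧ (G.mul g h, G.mul k g) ∈ G.dom ∧
    (h, k) ∈ G.dom ∧ (G.mul h k, g) ∈ G.dom ∧ (g, G.mul (G.mul h k) g) ∈ G.dom

lemma MoufangDefined.eq {g h k : E} (H : G.MoufangDefined g h k) :
    G.mul (G.mul g h) (G.mul k g) = G.mul g (G.mul (G.mul h k) g) :=
  G.moufang g h k H.1 H.2.1 H.2.2.1 H.2.2.2.1 H.2.2.2.2.1 H.2.2.2.2.2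

lemma moufangDefined_middle {h : E} (hh : h ∈ G.carrier) : G.MoufangDefined G.one h G.one := by
  simp [MoufangDefined, G.one_mul h hh, G.mul_one h hh, G.one_mul _ G.one_mem,
    G.one_mul_dom h hh, G.mul_one_dom h hh, G.one_mul_dom _ G.one_mem]

lemma moufangDefined_right {k : E} (hk : k ∈ G.carrier) : G.MoufangDefined G.one G.one k := by
  simp [MoufangDefined, G.one_mul k hk, G.mul_one k hk, G.one_mul _ G.one_mem,
    G.one_mul_dom k hk, G.mul_one_dom k hk, G.one_mul_dom _ G.one_mem]

lemma hasFDerivAt_self (h : E) : HasFDerivAt (fun k : E => k) (ContinuousLinearMap.id ℝ E) h :=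
  hasFDerivAt_id h

lemma hasDerivAt_line (a x : E) (t : ℝ) : HasDerivAt (fun s : ℝ => a + s • x) x t := by
  simpa using ((hasDerivAt_id t).smul_const x).const_add a

lemma hasDerivAt_comp_line {V : E → E} (hV : DifferentiableAt ℝ V G.one) (x : E) :
    HasDerivAt (fun s : ℝ => V (G.one + s • x)) (fderiv ℝ V G.one x) 0 := by
  have h0 : HasFDerivAt V (fderiv ℝ V G.one) (G.one + (0 : ℝ) • x) := by
    simpa using hV.hasFDerivAt
  exact h0.comp_hasDerivAt 0 (hasDerivAt_line G.one x 0)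

end Basic

section Derivatives

variable [CompleteSpace E] {G}

lemma contDiffAt_prodMul {p : E × E} (hp : p ∈ G.dom) : ContDiffAt ℝ ω G.prodMul p :=
  (G.analytic_mul p hp).contDiffAt

lemma contDiffAt_dMul {p : E × E} (hp : p ∈ G.dom) : ContDiffAt ℝ ω G.dMul p :=
  (contDiffAt_prodMul hp).fderiv_right (m := ω) le_rfl

lemma hasFDerivAt_prodMul {p : E × E} (hp : p ∈ G.dom) :
    HasFDerivAt G.prodMul (G.dMul p) p :=
  ((contDiffAt_prodMul hp).differentiableAt (by simp)).hasFDerivAt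

lemma hasFDerivAt_dMul {p : E × E} (hp : p ∈ G.dom) :
    HasFDerivAt G.dMul (G.ddMul p) p :=
  ((contDiffAt_dMul hp).differentiableAt (by simp)).hasFDerivAt

lemma ddMul_symm {p : E × E} (hp : p ∈ G.dom) (u v : E × E) :
    G.ddMul p u v = G.ddMul p v u :=
  (contDiffAt_prodMul hp).isSymmSndFDerivAt (by simp) u v

lemma hasFDerivAt_mul {X : Type*} [NormedAddCommGroup X] [NormedSpace ℝ X] {f g : X → E}
    {f' g' : X →L[ℝ] E} {t : X} (hf : HasFDerivAt f f' t) (hg : HasFDerivAt g g' t)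
    (hp : (f t, g t) ∈ G.dom) :
    HasFDerivAt (fun s => G.mul (f s) (g s)) (G.dMul (f t, g t) ∘L f'.prod g') t :=
  HasFDerivAt.comp (f := fun s => (f s, g s)) (g := G.prodMul) t (hasFDerivAt_prodMul hp)
    (hf.prodMk hg)

/-- The product of two differentiable curves. -/
lemma hasDerivAt_mul {f g : ℝ → E} {f' g' : E} {t : ℝ} (hf : HasDerivAt f f' t)
    (hg : HasDerivAt g g' t) (hp : (f t, g t) ∈ G.dom) :
    HasDerivAt (fun s => G.mul (f s) (g s)) (G.dMul (f t, g t) (f', g')) t := by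
  simpa using (hasFDerivAt_mul hf.hasFDerivAt hg.hasFDerivAt hp).hasDerivAt

lemma hasFDerivAt_dMul_comp {X : Type*} [NormedAddCommGroup X] [NormedSpace ℝ X] {f g : X → E}
    {f' g' : X →L[ℝ] E} {t : X} (hf : HasFDerivAt f f' t) (hg : HasFDerivAt g g' t)
    (hp : (f t, g t) ∈ G.dom) :
    HasFDerivAt (fun s => G.dMul (f s, g s)) (G.ddMul (f t, g t) ∘L f'.prod g') t :=
  HasFDerivAt.comp (f := fun s => (f s, g s)) (g := G.dMul) t (hasFDerivAt_dMul hp)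
    (hf.prodMk hg)

/-- The derivative of the product along differentiable curves of pairs and directions. -/
lemma hasDerivAt_dMul {f g u v : ℝ → E} {f' g' u' v' : E} {t : ℝ} (hf : HasDerivAt f f' t)
    (hg : HasDerivAt g g' t) (hu : HasDerivAt u u' t) (hv : HasDerivAt v v' t)
    (hp : (f t, g t) ∈ G.dom) :
    HasDerivAt (fun s => G.dMul (f s, g s) (u s, v s))
      (G.ddMul (f t, g t) (f', g') (u t, v t) + G.dMul (f t, g t) (u', v')) t := by
  have h : HasDerivAt (fun s => G.dMul (f s, g s)) (G.ddMul (f t, g t) (f', g')) t := by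
    simpa using (hasFDerivAt_dMul_comp hf.hasFDerivAt hg.hasFDerivAt hp).hasDerivAt
  exact h.clm_apply (hu.prodMk hv)

lemma L_apply (x : E) {h : E} (hh : h ∈ G.carrier) : G.L x h = G.dMul (G.one, h) (x, 0) := by
  simp [L, (hasFDerivAt_mul (hasFDerivAt_self G.one) (hasFDerivAt_const h G.one)
    (G.one_mul_dom h hh)).fderiv]

lemma R_apply (x : E) {h : E} (hh : h ∈ G.carrier) : G.R x h = G.dMul (h, G.one) (0, x) := by
  simp [R, (hasFDerivAt_mul (hasFDerivAt_const h G.one) (hasFDerivAt_self G.one)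
    (G.mul_one_dom h hh)).fderiv]

lemma hasFDerivAt_L (x : E) {h : E} (hh : h ∈ G.carrier) :
    HasFDerivAt (G.L x) ((G.ddMul (G.one, h)).flip (x, 0) ∘L ContinuousLinearMap.inr ℝ E E) h := by
  have := (hasFDerivAt_dMul_comp (hasFDerivAt_const G.one h) (hasFDerivAt_self h)
    (G.one_mul_dom h hh)).clm_apply (hasFDerivAt_const ((x, 0) : E × E) h)
  refine (this.congr_of_eventuallyEq
    (Filter.eventually_of_mem (carrier_mem_nhds hh) fun k hk => L_apply x hk)).congr_fderiv ?_
  ext v; simp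

lemma hasFDerivAt_R (x : E) {h : E} (hh : h ∈ G.carrier) :
    HasFDerivAt (G.R x) ((G.ddMul (h, G.one)).flip (0, x) ∘L ContinuousLinearMap.inl ℝ E E) h := by
  have := (hasFDerivAt_dMul_comp (hasFDerivAt_self h) (hasFDerivAt_const G.one h)
    (G.mul_one_dom h hh)).clm_apply (hasFDerivAt_const ((0, x) : E × E) h)
  refine (this.congr_of_eventuallyEq
    (Filter.eventually_of_mem (carrier_mem_nhds hh) fun k hk => R_apply x hk)).congr_fderiv ?_
  ext v; simp

lemma contDiffAt_L (x : E) {h : E} (hh : h ∈ G.carrier) : ContDiffAt ℝ ω (G.L x) h := by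
  have : ContDiffAt ℝ ω (fun k => G.dMul (G.one, k) (x, 0)) h :=
    ((contDiffAt_dMul (G.one_mul_dom h hh)).comp h
      (contDiffAt_const.prodMk contDiffAt_id)).clm_apply contDiffAt_const
  exact this.congr_of_eventuallyEq
    (Filter.eventually_of_mem (carrier_mem_nhds hh) fun k hk => L_apply x hk)

lemma contDiffAt_R (x : E) {h : E} (hh : h ∈ G.carrier) : ContDiffAt ℝ ω (G.R x) h := by
  have : ContDiffAt ℝ ω (fun k => G.dMul (k, G.one) (0, x)) h :=
    ((contDiffAt_dMul (G.mul_one_dom h hh)).comp h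
      (contDiffAt_id.prodMk contDiffAt_const)).clm_apply contDiffAt_const
  exact this.congr_of_eventuallyEq
    (Filter.eventually_of_mem (carrier_mem_nhds hh) fun k hk => R_apply x hk)

lemma dMul_one_left (v : E) {h : E} (hh : h ∈ G.carrier) : G.dMul (G.one, h) (0, v) = v := by
  have h1 := hasFDerivAt_mul (hasFDerivAt_const G.one h) (hasFDerivAt_self h) (G.one_mul_dom h hh)
  have h2 := (hasFDerivAt_id (𝕜 := ℝ) h).congr_of_eventuallyEq
    (Filter.eventually_of_mem (carrier_mem_nhds hh) fun k hk => G.one_mul k hk)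
  simpa using congrArg (fun T : E →L[ℝ] E => T v) (h1.unique h2)

lemma dMul_one_right (v : E) {h : E} (hh : h ∈ G.carrier) : G.dMul (h, G.one) (v, 0) = v := by
  have h1 := hasFDerivAt_mul (hasFDerivAt_self h) (hasFDerivAt_const G.one h) (G.mul_one_dom h hh)
  have h2 := (hasFDerivAt_id (𝕜 := ℝ) h).congr_of_eventuallyEq
    (Filter.eventually_of_mem (carrier_mem_nhds hh) fun k hk => G.mul_one k hk)
  simpa using congrArg (fun T : E →L[ℝ] E => T v) (h1.unique h2)

/-- Left multiplication by the unit is the identity near `h`, so its first derivative is constant.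
-/
lemma ddMul_one_left (u v : E) {h : E} (hh : h ∈ G.carrier) :
    G.ddMul (G.one, h) (0, u) (0, v) = 0 := by
  have h1 := (hasFDerivAt_dMul_comp (hasFDerivAt_const G.one h) (hasFDerivAt_self h)
    (G.one_mul_dom h hh)).clm_apply (hasFDerivAt_const ((0, v) : E × E) h)
  have h2 := (hasFDerivAt_const (𝕜 := ℝ) v h).congr_of_eventuallyEq
    (Filter.eventually_of_mem (carrier_mem_nhds hh) fun k hk => dMul_one_left v hk)
  simpa using congrArg (fun T : E →L[ℝ] E => T u) (h1.unique h2)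

lemma ddMul_one_right (u v : E) {h : E} (hh : h ∈ G.carrier) :
    G.ddMul (h, G.one) (u, 0) (v, 0) = 0 := by
  have h1 := (hasFDerivAt_dMul_comp (hasFDerivAt_self h) (hasFDerivAt_const G.one h)
    (G.mul_one_dom h hh)).clm_apply (hasFDerivAt_const ((v, 0) : E × E) h)
  have h2 := (hasFDerivAt_const (𝕜 := ℝ) v h).congr_of_eventuallyEq
    (Filter.eventually_of_mem (carrier_mem_nhds hh) fun k hk => dMul_one_right v hk)
  simpa using congrArg (fun T : E →L[ℝ] E => T u) (h1.unique h2)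

lemma fderiv_L (x u : E) {h : E} (hh : h ∈ G.carrier) :
    fderiv ℝ (G.L x) h u = G.ddMul (G.one, h) (0, u) (x, 0) := by
  simp [(hasFDerivAt_L x hh).fderiv]

lemma fderiv_R (x u : E) {h : E} (hh : h ∈ G.carrier) :
    fderiv ℝ (G.R x) h u = G.ddMul (h, G.one) (u, 0) (0, x) := by
  simp [(hasFDerivAt_R x hh).fderiv]

lemma taylorCoeff_eq (x y : E) :
    G.taylorCoeff x y = G.ddMul (G.one, G.one) (0, y) (x, 0) :=
  fderiv_L x y G.one_mem

/-- The block in which both directions lie in the second factor vanishes by `ddMul_one_left`; only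
the mixed block survives, and it is the derivative of `L_x`. -/
lemma ddMul_one_left_mixed (x u v : E) {h : E} (hh : h ∈ G.carrier) :
    G.ddMul (G.one, h) (x, u) (0, v) = fderiv ℝ (G.L x) h v := by
  rw [fderiv_L x v hh, ddMul_symm (G.one_mul_dom h hh) (0, v), ← sub_eq_zero, ← sub_apply,
    ← map_sub, Prod.mk_sub_mk, sub_self, ddMul_one_left _ v hh]

lemma ddMul_one_right_mixed (x u v : E) {h : E} (hh : h ∈ G.carrier) :
    G.ddMul (h, G.one) (u, x) (v, 0) = fderiv ℝ (G.R x) h v := by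
  rw [fderiv_R x v hh, ddMul_symm (G.mul_one_dom h hh) (v, 0), ← sub_eq_zero, ← sub_apply,
    ← map_sub, Prod.mk_sub_mk, sub_self, ddMul_one_right _ v hh]

/-- The second derivative at `(e, h)`, split into its blocks. -/
lemma ddMul_one_left_split (x y u v : E) {h : E} (hh : h ∈ G.carrier) :
    G.ddMul (G.one, h) (x, u) (y, v) =
      G.ddMul (G.one, h) (x, 0) (y, 0) + fderiv ℝ (G.L y) h u + fderiv ℝ (G.L x) h v := by
  have e : ∀ a b : E, ((a, b) : E × E) = (a, 0) + (0, b) := by simp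
  rw [← ddMul_one_left_mixed x u v hh, fderiv_L y u hh, e y v, map_add, e x u]
  simp only [map_add, add_apply]

/-- The second derivative at `(h, e)`, split into its blocks. -/
lemma ddMul_one_right_split (x y u v : E) {h : E} (hh : h ∈ G.carrier) :
    G.ddMul (h, G.one) (u, x) (v, y) =
      G.ddMul (h, G.one) (0, x) (0, y) + fderiv ℝ (G.R y) h u + fderiv ℝ (G.R x) h v := by
  have e : ∀ a b : E, ((a, b) : E × E) = (a, 0) + (0, b) := by simp
  rw [← ddMul_one_right_mixed x u v hh, fderiv_R y u hh, e v y, map_add, e u x]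
  simp only [map_add, add_apply]
  abel

end Derivatives

section Nhds

variable [CompleteSpace E] {G}

lemma continuousAt_mul {X : Type*} [TopologicalSpace X] {f g : X → E} {t : X}
    (hf : ContinuousAt f t) (hg : ContinuousAt g t) (hp : (f t, g t) ∈ G.dom) :
    ContinuousAt (fun s => G.mul (f s) (g s)) t :=
  (hasFDerivAt_prodMul hp).continuousAt.comp (f := fun s => (f s, g s)) (hf.prodMk hg)

/-- Definedness amounts to six open conditions, so it persists along continuous curves; this is what
allows the local identity to be differentiated. -/
lemma MoufangDefined.eventually {X : Type*} [TopologicalSpace X] {f g k : X → E} {t : X}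
    (hf : ContinuousAt f t) (hg : ContinuousAt g t) (hk : ContinuousAt k t)
    (H : G.MoufangDefined (f t) (g t) (k t)) : ∀ᶠ s in 𝓝 t, G.MoufangDefined (f s) (g s) (k s) := by
  obtain ⟨h1, h2, h3, h4, h5, h6⟩ := H
  have c1 := continuousAt_mul hf hg h1
  have c2 := continuousAt_mul hk hf h2
  have c4 := continuousAt_mul hg hk h4
  filter_upwards [eventually_dom hf hg h1, eventually_dom hk hf h2, eventually_dom c1 c2 h3,
    eventually_dom hg hk h4, eventually_dom c4 hf h5,
    eventually_dom hf (continuousAt_mul c4 hf h5) h6] with s a1 a2 a3 a4 a5 a6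
  exact ⟨a1, a2, a3, a4, a5, a6⟩

end Nhds

/-! ### From the Moufang identity to the generalized Maurer–Cartan relations. -/

section FirstOrder

variable [CompleteSpace E] {G}

/-- The Moufang identity `(a h)(b a) = a ((h b) a)`, differentiated in `b` at the unit. -/
lemma deriv_moufang_right {a h : E} (hh : h ∈ G.carrier) (H : G.MoufangDefined a h G.one) (y : E) :
    G.dMul (G.mul a h, a) (0, G.L y a) =
      G.dMul (a, G.mul h a) (0, G.dMul (h, a) (G.R y h, 0)) := by
  have ha : a ∈ G.carrier := (G.dom_subset H.1).1
  have hb := hasDerivAt_line G.one y 0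
  have ev : ∀ᶠ s : ℝ in 𝓝 0, G.MoufangDefined a h (G.one + s • y) :=
    MoufangDefined.eventually continuousAt_const continuousAt_const hb.continuousAt (by simpa using H)
  obtain ⟨h1, h2, h3, h4, h5, h6⟩ := H
  simp only [G.one_mul a ha, G.mul_one h hh] at h3 h5 h6
  have l1 := hasDerivAt_mul hb (hasDerivAt_const (0 : ℝ) a) (by simpa using h2)
  have l2 := hasDerivAt_mul (hasDerivAt_const (0 : ℝ) (G.mul a h)) l1
    (by simpa [G.one_mul a ha] using h3)
  have r1 := hasDerivAt_mul (hasDerivAt_const (0 : ℝ) h) hb (by simpa using h4)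
  have r2 := hasDerivAt_mul r1 (hasDerivAt_const (0 : ℝ) a)
    (by simpa [G.mul_one h hh] using h5)
  have r3 := hasDerivAt_mul (hasDerivAt_const (0 : ℝ) a) r2
    (by simpa [G.mul_one h hh] using h6)
  have := l2.unique (r3.congr_of_eventuallyEq (ev.mono fun s hs => hs.eq))
  simpa [G.one_mul a ha, G.mul_one h hh, L_apply y ha, R_apply y hh] using this

/-- The Moufang identity `(a b)(k a) = a ((b k) a)`, differentiated in `b` at the unit. -/
lemma deriv_moufang_left {a k : E} (hk : k ∈ G.carrier) (H : G.MoufangDefined a G.one k) (y : E) :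
    G.dMul (a, G.mul k a) (G.R y a, 0) =
      G.dMul (a, G.mul k a) (0, G.dMul (k, a) (G.L y k, 0)) := by
  have ha : a ∈ G.carrier := (G.dom_subset H.1).1
  have hb := hasDerivAt_line G.one y 0
  have ev : ∀ᶠ s : ℝ in 𝓝 0, G.MoufangDefined a (G.one + s • y) k :=
    MoufangDefined.eventually continuousAt_const hb.continuousAt continuousAt_const (by simpa using H)
  obtain ⟨h1, h2, h3, h4, h5, h6⟩ := H
  simp only [G.mul_one a ha, G.one_mul k hk] at h3 h5 h6
  have l1 := hasDerivAt_mul (hasDerivAt_const (0 : ℝ) a) hb (by simpa using h1)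
  have l2 := hasDerivAt_mul l1 (hasDerivAt_const (0 : ℝ) (G.mul k a))
    (by simpa [G.mul_one a ha] using h3)
  have r1 := hasDerivAt_mul hb (hasDerivAt_const (0 : ℝ) k) (by simpa using h4)
  have r2 := hasDerivAt_mul r1 (hasDerivAt_const (0 : ℝ) a)
    (by simpa [G.one_mul k hk] using h5)
  have r3 := hasDerivAt_mul (hasDerivAt_const (0 : ℝ) a) r2
    (by simpa [G.one_mul k hk] using h6)
  have := l2.unique (r3.congr_of_eventuallyEq (ev.mono fun s hs => hs.eq))
  simpa [G.mul_one a ha, G.one_mul k hk, L_apply y hk, R_apply y ha] using this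

lemma hasDerivAt_const_mul_line (x : E) {h : E} (hh : h ∈ G.carrier) :
    HasDerivAt (fun s : ℝ => G.mul h (G.one + s • x)) (G.R x h) 0 := by
  have := hasDerivAt_mul (hasDerivAt_const (0 : ℝ) h) (hasDerivAt_line G.one x 0)
    (by simpa using G.mul_one_dom h hh)
  simpa [R_apply x hh] using this

lemma hasDerivAt_line_mul_const (x : E) {h : E} (hh : h ∈ G.carrier) :
    HasDerivAt (fun s : ℝ => G.mul (G.one + s • x) h) (G.L x h) 0 := by
  have := hasDerivAt_mul (hasDerivAt_line G.one x 0) (hasDerivAt_const (0 : ℝ) h)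
    (by simpa using G.one_mul_dom h hh)
  simpa [L_apply x hh] using this

lemma L_one (y : E) : G.L y G.one = y := by
  rw [L_apply y G.one_mem, dMul_one_right y G.one_mem]

lemma R_one (y : E) : G.R y G.one = y := by
  rw [R_apply y G.one_mem, dMul_one_left y G.one_mem]

lemma fderiv_R_one (x y : E) : fderiv ℝ (G.R y) G.one x = G.taylorCoeff x y := by
  rw [fderiv_R y x G.one_mem, taylorCoeff_eq, ddMul_symm (G.one_mul_dom _ G.one_mem)]

/-- This is the derivative of `deriv_moufang_right` along `a = e + s x` at `s = 0`. The pure second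
derivative on the left is symmetric in `x` and `y`, hence drops out on antisymmetrizing. -/
lemma R_taylorCoeff (x y : E) {h : E} (hh : h ∈ G.carrier) :
    G.ddMul (h, G.one) (0, x) (0, y) + G.R (G.taylorCoeff y x) h =
      fderiv ℝ (G.L x) h (G.R y h) - fderiv ℝ (G.R y) h (G.L x h)
        + fderiv ℝ (G.R x) h (G.R y h) := by
  have hline := hasDerivAt_line G.one x 0
  have ev : ∀ᶠ s : ℝ in 𝓝 0, G.MoufangDefined (G.one + s • x) h G.one :=
    MoufangDefined.eventually hline.continuousAt continuousAt_const continuousAt_const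
      (by simpa using moufangDefined_middle hh)
  have l := hasDerivAt_dMul (hasDerivAt_line_mul_const x hh) hline (hasDerivAt_const (0 : ℝ) (0 : E))
    (hasDerivAt_comp_line ((hasFDerivAt_L y G.one_mem).differentiableAt) x)
    (by simpa [G.one_mul h hh] using G.mul_one_dom h hh)
  have r1 := hasDerivAt_dMul (hasDerivAt_const (0 : ℝ) h) hline
    (hasDerivAt_const (0 : ℝ) (G.R y h)) (hasDerivAt_const (0 : ℝ) (0 : E))
    (by simpa using G.mul_one_dom h hh)
  have r2 := hasDerivAt_dMul hline (hasDerivAt_const_mul_line x hh)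
    (hasDerivAt_const (0 : ℝ) (0 : E)) r1
    (by simpa [G.mul_one h hh] using G.one_mul_dom h hh)
  have e := l.unique (r2.congr_of_eventuallyEq
    (ev.mono fun s hs => deriv_moufang_right hh hs y))
  simp only [zero_smul, add_zero, G.one_mul h hh, G.mul_one h hh, L_one,
    dMul_one_right _ hh, dMul_one_left _ hh, ← R_apply _ hh, Prod.mk_zero_zero, map_zero] at e
  rw [ddMul_one_right_mixed _ _ _ hh, ddMul_one_right_split _ _ _ _ hh,
    ddMul_one_left_mixed _ _ _ hh, map_zero, add_zero] at e
  -- By definition, the derivative of `L_y` at the unit in the direction `x` is the Taylor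
  -- coefficient `a(y, x)`.
  change _ + G.R (G.taylorCoeff y x) h = _ at e
  linear_combination (norm := module) e

/-- The counterpart for `deriv_moufang_left`; here the derivative of `R_y` at the unit produces
`a(x, y)`, with the arguments in the other order. -/
lemma L_taylorCoeff (x y : E) {h : E} (hh : h ∈ G.carrier) :
    G.ddMul (G.one, h) (x, 0) (y, 0) + G.L (G.taylorCoeff x y) h =
      fderiv ℝ (G.L x) h (G.L y h) - fderiv ℝ (G.L y) h (G.R x h)
        + fderiv ℝ (G.R x) h (G.L y h) := by
  have hline := hasDerivAt_line G.one x 0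
  have ev : ∀ᶠ s : ℝ in 𝓝 0, G.MoufangDefined (G.one + s • x) G.one h :=
    MoufangDefined.eventually hline.continuousAt continuousAt_const continuousAt_const
      (by simpa using moufangDefined_right hh)
  have l := hasDerivAt_dMul hline (hasDerivAt_const_mul_line x hh)
    (hasDerivAt_comp_line ((hasFDerivAt_R y G.one_mem).differentiableAt) x)
    (hasDerivAt_const (0 : ℝ) (0 : E))
    (by simpa [G.mul_one h hh] using G.one_mul_dom h hh)
  have r1 := hasDerivAt_dMul (hasDerivAt_const (0 : ℝ) h) hline
    (hasDerivAt_const (0 : ℝ) (G.L y h)) (hasDerivAt_const (0 : ℝ) (0 : E))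
    (by simpa using G.mul_one_dom h hh)
  have r2 := hasDerivAt_dMul hline (hasDerivAt_const_mul_line x hh)
    (hasDerivAt_const (0 : ℝ) (0 : E)) r1
    (by simpa [G.mul_one h hh] using G.one_mul_dom h hh)
  have e := l.unique (r2.congr_of_eventuallyEq
    (ev.mono fun s hs => deriv_moufang_left hh hs y))
  simp only [zero_smul, add_zero, G.mul_one h hh, R_one, fderiv_R_one,
    dMul_one_right _ hh, dMul_one_left _ hh, ← L_apply _ hh, Prod.mk_zero_zero, map_zero] at e
  rw [ddMul_one_left_mixed _ _ _ hh, ddMul_one_left_split _ _ _ _ hh,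
    ddMul_one_right_mixed _ _ _ hh, map_zero, add_zero] at e
  linear_combination (norm := module) e

/-- The flexible law `(a h) a = a (h a)` to second order. -/
lemma lieBracket_L_R_self (x : E) {h : E} (hh : h ∈ G.carrier) :
    lieBracket ℝ (G.L x) (G.R x) h = 0 := by
  have hline := hasDerivAt_line G.one x 0
  have ev : ∀ᶠ s : ℝ in 𝓝 0, G.MoufangDefined (G.one + s • x) h G.one :=
    MoufangDefined.eventually hline.continuousAt continuousAt_const continuousAt_const
      (by simpa using moufangDefined_middle hh)
  -- A second differentiation at `0` needs the first derivative of the flexible law at every nearby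
  -- `s`, hence the use of `eventually_nhds`.
  have fst : ∀ᶠ s : ℝ in 𝓝 0,
      G.dMul (G.mul (G.one + s • x) h, G.one + s • x) (G.dMul (G.one + s • x, h) (x, 0), x) =
      G.dMul (G.one + s • x, G.mul h (G.one + s • x)) (x, G.dMul (h, G.one + s • x) (0, x)) := by
    filter_upwards [ev, ev.eventually_nhds] with s hs hs'
    have hc : G.one + s • x ∈ G.carrier := (G.dom_subset hs.1).1
    have flex : ∀ᶠ t : ℝ in 𝓝 s, G.mul (G.mul (G.one + t • x) h) (G.one + t • x) =
        G.mul (G.one + t • x) (G.mul h (G.one + t • x)) := hs'.mono fun t ht => by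
      have := ht.eq
      rwa [G.one_mul _ (G.dom_subset ht.1).1, G.mul_one h hh] at this
    obtain ⟨h1, h2, h3, h4, h5, h6⟩ := hs
    simp only [G.one_mul _ hc, G.mul_one h hh] at h3 h5 h6
    have b := hasDerivAt_line G.one x s
    have c := hasDerivAt_const s h
    exact (hasDerivAt_mul (hasDerivAt_mul b c h1) b h3).unique
      ((hasDerivAt_mul b (hasDerivAt_mul c b h5) h6).congr_of_eventuallyEq flex)
  have c0 := hasDerivAt_const (0 : ℝ) (0 : E)
  have cx := hasDerivAt_const (0 : ℝ) x
  have ch := hasDerivAt_const (0 : ℝ) h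
  have d1 : (G.one + (0 : ℝ) • x, h) ∈ G.dom := by simpa using G.one_mul_dom h hh
  have d2 : (h, G.one + (0 : ℝ) • x) ∈ G.dom := by simpa using G.mul_one_dom h hh
  have l := hasDerivAt_dMul (hasDerivAt_line_mul_const x hh) hline
    (hasDerivAt_dMul hline ch cx c0 d1) cx
    (by simpa [G.one_mul h hh] using G.mul_one_dom h hh)
  have r := hasDerivAt_dMul hline (hasDerivAt_const_mul_line x hh) cx
    (hasDerivAt_dMul ch hline c0 cx d2)
    (by simpa [G.mul_one h hh] using G.one_mul_dom h hh)
  have e := l.unique (r.congr_of_eventuallyEq fst)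
  simp only [zero_smul, add_zero, G.one_mul h hh, G.mul_one h hh,
    dMul_one_right _ hh, dMul_one_left _ hh, ← L_apply _ hh, ← R_apply _ hh] at e
  rw [ddMul_one_left_split x x (G.R x h) (G.R x h) hh,
    ddMul_one_right_split x x (G.L x h) (G.L x h) hh] at e
  rw [lieBracket]
  -- The pure second derivatives agree on both sides; each mixed derivative occurs twice, whence the
  -- factor `1/2`.
  linear_combination (norm := module) (1 / 2 : ℝ) • e

/-- The polarized flexible law. -/
lemma lieBracket_L_R (x y : E) {h : E} (hh : h ∈ G.carrier) :
    lieBracket ℝ (G.L x) (G.R y) h = lieBracket ℝ (G.R x) (G.L y) h := by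
  have dL := fun z => (hasFDerivAt_L z hh).differentiableAt
  have dR := fun z => (hasFDerivAt_R z hh).differentiableAt
  have e := lieBracket_L_R_self (x + y) hh
  rw [L_add, R_add, lieBracket_add_left (dL x) (dL y), lieBracket_add_right (dR x) (dR y),
    lieBracket_add_right (dR x) (dR y), lieBracket_L_R_self x hh, lieBracket_L_R_self y hh,
    lieBracket_swap (V := G.L y)] at e
  linear_combination (norm := module) e

/-- Antisymmetrizing `L_taylorCoeff` yields `-[L_x, L_y] - [L_x, R_y] - [R_x, L_y]`; the polarized
flexible law merges the last two terms. -/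
lemma L_bracket (x y : E) {h : E} (hh : h ∈ G.carrier) :
    G.L (G.bracket x y) h =
      -lieBracket ℝ (G.L x) (G.L y) h - (2 : ℝ) • lieBracket ℝ (G.L x) (G.R y) h := by
  have e1 := L_taylorCoeff x y hh
  have e2 := L_taylorCoeff y x hh
  have e3 := lieBracket_L_R x y hh
  rw [ddMul_symm (G.one_mul_dom h hh)] at e2
  have e4 : G.L (G.bracket x y) h = G.L (G.taylorCoeff x y) h - G.L (G.taylorCoeff y x) h := by
    simp [bracket, L]
  simp only [lieBracket] at e3 ⊢
  linear_combination (norm := module) e4 + e1 - e2 + e3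

lemma R_bracket (x y : E) {h : E} (hh : h ∈ G.carrier) :
    G.R (G.bracket x y) h =
      lieBracket ℝ (G.R x) (G.R y) h + (2 : ℝ) • lieBracket ℝ (G.L x) (G.R y) h := by
  have e1 := R_taylorCoeff y x hh
  have e2 := R_taylorCoeff x y hh
  have e3 := lieBracket_L_R x y hh
  rw [ddMul_symm (G.mul_one_dom h hh)] at e2
  have e4 : G.R (G.bracket x y) h = G.R (G.taylorCoeff x y) h - G.R (G.taylorCoeff y x) h := by
    simp [bracket, R]
  simp only [lieBracket] at e3 ⊢
  linear_combination (norm := module) e4 + e1 - e2 - e3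

end FirstOrder

end LocalAnalyticMoufangLoop
end

/-! ### Transfer of the algebraic identities to the local loop. -/

noncomputable section

namespace LocalAnalyticMoufangLoop

open scoped ContDiff

variable {E : Type*} [NormedAddCommGroup E] [NormedSpace ℝ E] (G : LocalAnalyticMoufangLoop E)

/-- The carrier as an open set of `E`. -/
def opens : TopologicalSpace.Opens E := ⟨G.carrier, G.isOpen_carrier⟩

lemma bracket_swap (x y : E) : G.bracket x y = -G.bracket y x := by simp [bracket]

/-- The Lie bracket at a point depends only on germs, so on the open carrier the cut-off fields may
replace the translations. -/
lemma tripleClosed_of_field {G : LocalAnalyticMoufangLoop E} {T : E → E → E}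
    {F : E → smoothVectorFields G.opens} (hF : ∀ x, ∀ g ∈ G.opens, (F x).1 g = T x g)
    (h : ∀ x y z, ⁅⁅F x, F y⁆, F z⁆ = F (G.loos x y z)) : G.TripleClosed T := fun x y z g hg => by
  rw [← hF _ g hg, ← h]
  exact (smoothVectorFields.lieBracket_eq
    (smoothVectorFields.lieBracket_eq (hF x) (hF y)) (hF z) g hg).symm

section Fields

variable [CompleteSpace E]

lemma contDiffOn_L (x : E) : ContDiffOn ℝ ∞ (G.L x) G.opens :=
  fun _ hh => ((contDiffAt_L x hh).of_le le_top).contDiffWithinAt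

lemma contDiffOn_R (x : E) : ContDiffOn ℝ ∞ (G.R x) G.opens :=
  fun _ hh => ((contDiffAt_R x hh).of_le le_top).contDiffWithinAt

/-- The left translations as smooth vector fields on the carrier. -/
def fieldL : E →ₗ[ℝ] smoothVectorFields G.opens where
  toFun x := smoothVectorFields.ofContDiffOn (G.contDiffOn_L x)
  map_add' x y := smoothVectorFields.ext_on fun g hg => by
    simp only [smoothVectorFields.ofContDiffOn_apply _ hg, L_add, Submodule.coe_add, Pi.add_apply]
  map_smul' c x := smoothVectorFields.ext_on fun g hg => by
    simp only [smoothVectorFields.ofContDiffOn_apply _ hg, L_smul, Submodule.coe_smul,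
      Pi.smul_apply, RingHom.id_apply]

/-- The right translations as smooth vector fields on the carrier. -/
def fieldR : E →ₗ[ℝ] smoothVectorFields G.opens where
  toFun x := smoothVectorFields.ofContDiffOn (G.contDiffOn_R x)
  map_add' x y := smoothVectorFields.ext_on fun g hg => by
    simp only [smoothVectorFields.ofContDiffOn_apply _ hg, R_add, Submodule.coe_add, Pi.add_apply]
  map_smul' c x := smoothVectorFields.ext_on fun g hg => by
    simp only [smoothVectorFields.ofContDiffOn_apply _ hg, R_smul, Submodule.coe_smul,
      Pi.smul_apply, RingHom.id_apply]

lemma fieldL_apply (x : E) : ∀ g ∈ G.opens, (G.fieldL x).1 g = G.L x g :=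
  fun _ hg => smoothVectorFields.ofContDiffOn_apply (G.contDiffOn_L x) hg

lemma fieldR_apply (x : E) : ∀ g ∈ G.opens, (G.fieldR x).1 g = G.R x g :=
  fun _ hg => smoothVectorFields.ofContDiffOn_apply (G.contDiffOn_R x) hg

lemma fieldM_apply (x : E) :
    ∀ g ∈ G.opens, (-(G.fieldL x + G.fieldR x)).1 g = G.M x g := fun g hg => by
  simp [M, fieldL_apply G x g hg, fieldR_apply G x g hg]

lemma isMoufangPair : IsMoufangPair G.bracket G.fieldL G.fieldR where
  swap x y := by simp [bracket]
  comm x y := smoothVectorFields.ext_on fun g hg => by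
    rw [smoothVectorFields.lieBracket_eq (G.fieldL_apply x) (G.fieldR_apply y) g hg,
      smoothVectorFields.lieBracket_eq (G.fieldR_apply x) (G.fieldL_apply y) g hg,
      lieBracket_L_R x y hg]
  left x y := smoothVectorFields.ext_on fun g hg => by
    rw [G.fieldL_apply _ g hg, L_bracket x y hg,
      ← smoothVectorFields.lieBracket_eq (G.fieldL_apply x) (G.fieldL_apply y) g hg,
      ← smoothVectorFields.lieBracket_eq (G.fieldL_apply x) (G.fieldR_apply y) g hg]
    rfl
  right x y := smoothVectorFields.ext_on fun g hg => by
    rw [G.fieldR_apply _ g hg, R_bracket x y hg,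
      ← smoothVectorFields.lieBracket_eq (G.fieldR_apply x) (G.fieldR_apply y) g hg,
      ← smoothVectorFields.lieBracket_eq (G.fieldL_apply x) (G.fieldR_apply y) g hg]
    rfl

lemma bracket_neg_right (x y : E) : G.bracket x (-y) = -G.bracket x y := by
  simp only [bracket, taylorCoeff_eq]
  have e : ∀ a : E, ((0, -a) : E × E) = -(0, a) := by simp
  have e' : ∀ a : E, ((-a, 0) : E × E) = -(a, 0) := by simp
  rw [e, e', map_neg, map_neg, neg_apply]
  abel

/-- By anticommutativity, the first two terms of the Yamaguti bracket are `-[[y,z],x] - [[z,x],y]`,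
which is the negative of the Jacobian with `[[x,y],z]` restored. -/
lemma yamaguti_eq (x y z : E) : G.yamaguti x y z =
    (2 : ℝ) • G.bracket (G.bracket x y) z - IsMoufangPair.jacobian G.bracket x y z := by
  rw [yamaguti, IsMoufangPair.jacobian, G.bracket_swap x (G.bracket y z), G.bracket_swap x z,
    bracket_neg_right, G.bracket_swap y (G.bracket z x)]
  module

lemma loos_eq (x y z : E) : G.loos x y z =
    G.bracket (G.bracket x y) z - (1 / 3 : ℝ) • IsMoufangPair.jacobian G.bracket x y z := by
  rw [loos, yamaguti_eq]; module

variable {G}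

/-- Six times the Yamagutian, as a smooth vector field on the carrier. -/
def fieldY (G : LocalAnalyticMoufangLoop E) (x y : E) : smoothVectorFields G.opens :=
  ⁅G.fieldL x, G.fieldL y⁆ + ⁅G.fieldR x, G.fieldR y⁆ +
    ⁅-(G.fieldL x + G.fieldR x), -(G.fieldL y + G.fieldR y)⁆

lemma fieldY_apply (x y : E) :
    ∀ g ∈ G.opens, ((1 / 6 : ℝ) • G.fieldY x y).1 g = G.Y x y g := fun g hg => by
  rw [Y, ← smoothVectorFields.lieBracket_eq (G.fieldL_apply x) (G.fieldL_apply y) g hg,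
    ← smoothVectorFields.lieBracket_eq (G.fieldR_apply x) (G.fieldR_apply y) g hg,
    ← smoothVectorFields.lieBracket_eq (G.fieldM_apply x) (G.fieldM_apply y) g hg]
  rfl

lemma reductive_of_field {T : E → E → E}
    {F : E → smoothVectorFields G.opens} (hF : ∀ x, ∀ g ∈ G.opens, (F x).1 g = T x g)
    (h : ∀ x y z, ⁅G.fieldY x y, F z⁆ = F (G.yamaguti x y z)) : G.Reductive T := fun x y z g hg => by
  have e : (6 : ℝ) • ⁅(1 / 6 : ℝ) • G.fieldY x y, F z⁆ = F (G.yamaguti x y z) := by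
    rw [smul_lie, h]; module
  rw [← hF _ g hg, ← e, Submodule.coe_smul, Pi.smul_apply,
    smoothVectorFields.lieBracket_eq (fieldY_apply x y) (hF z) g hg]

lemma tripleClosed_L : G.TripleClosed G.L :=
  tripleClosed_of_field G.fieldL_apply fun x y z => by
    rw [G.isMoufangPair.left_triple, loos_eq, map_sub, map_smul]

lemma tripleClosed_R : G.TripleClosed G.R :=
  tripleClosed_of_field G.fieldR_apply fun x y z => by
    rw [G.isMoufangPair.right_triple, loos_eq, map_sub, map_smul]

lemma tripleClosed_M : G.TripleClosed G.M :=
  tripleClosed_of_field (F := fun x => -(G.fieldL x + G.fieldR x)) G.fieldM_apply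
    fun x y z => by
      rw [G.isMoufangPair.middle_triple, loos_eq, map_sub, map_smul, map_sub, map_smul]

lemma reductive_L : G.Reductive G.L :=
  reductive_of_field G.fieldL_apply fun x y z => by
    rw [fieldY, G.isMoufangPair.yamagutian_left, yamaguti_eq, map_sub, map_smul]

lemma reductive_R : G.Reductive G.R :=
  reductive_of_field G.fieldR_apply fun x y z => by
    rw [fieldY, G.isMoufangPair.yamagutian_right, yamaguti_eq, map_sub, map_smul]

lemma reductive_M : G.Reductive G.M :=
  reductive_of_field (F := fun x => -(G.fieldL x + G.fieldR x)) G.fieldM_apply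
    fun x y z => by
      rw [lie_neg, lie_add, fieldY, G.isMoufangPair.yamagutian_left,
        G.isMoufangPair.yamagutian_right, yamaguti_eq, map_sub, map_smul, map_sub, map_smul]

end Fields

end LocalAnalyticMoufangLoop

end

theorem mainTheorem1 {E : Type*} [NormedAddCommGroup E] [NormedSpace ℝ E]
    [FiniteDimensional ℝ E] (G : LocalAnalyticMoufangLoop E) :
    (G.TripleClosed G.L ∧ G.TripleClosed G.R ∧ G.TripleClosed G.M) ∧
    ((G.TripleClosed G.L ∧ G.TripleClosed G.R ∧ G.TripleClosed G.M) ↔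
      (G.Reductive G.L ∧ G.Reductive G.R ∧ G.Reductive G.M)) := by
  have : CompleteSpace E := FiniteDimensional.complete ℝ E
  open LocalAnalyticMoufangLoop in
  exact ⟨⟨tripleClosed_L, tripleClosed_R, tripleClosed_M⟩,
    fun _ => ⟨reductive_L, reductive_R, reductive_M⟩,
    fun _ => ⟨tripleClosed_L, tripleClosed_R, tripleClosed_M⟩⟩
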